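/- For a function $f : S \to \Sigma$ with $S \subseteq \{0,1\}^N$, let $$\mathrm{ADV}(f) := \max_{\Gamma} \frac{\|\Gamma\|}{\max_{1\le i\le N} \|\Gamma \circ D_i\|},$$ where the maximum is over all nonzero, entrywise non-negative real square matrices $\Gamma$ with rows and columns indexed by $S$ such that $\Gamma[x,y]=0$ whenever $f(x)=f(y)$; $\|\cdot\|$ is the spectral norm, $\circ$ is the entrywise product, and $D_i[x,y]=1$ if $x_i\neq y_i$ and $D_i[x,y]=0$ otherwise. For $n\ge 1$ let $\mathrm{OSP}_n$ be the symmetrized ordered search problem: its inputs are the $2n$ cyclic shifts of the string of $n$ ones followed by $n$ zeros, and it takes a different value on each input (it identifies the input). Then the maximum defining $\mathrm{ADV}(\mathrm{OSP}_n)$ is attained for every $n\ge 1$, and, as $n\to\infty$, $$\mathrm{ADV}(\mathrm{OSP}_n) = \frac{2}{\pi}\left(\ln n + \gamma + \ln 8\right) + O(1/n),$$ where $\gamma$ is the Euler–Mascheroni constant. Moreover, with $\xi_i := \binom{2i}{i}/4^i$, as $m\to\infty$, $$\sum_{i=0}^{m-1} \xi_i^2 = \frac{1}{\pi}\left(\ln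 m + \gamma + \ln 16\right) + O(1/m).$$ -/

import Mathlib

/-- The spectral norm of a real square matrix: its operator norm on Euclidean space. -/
noncomputable def matSpectralNorm {ι : Type*} [Fintype ι] [DecidableEq ι] (A : Matrix ι ι ℝ) : ℝ :=
  ‖Matrix.toEuclideanCLM (𝕜 := ℝ) A‖

/-- The zero/one matrix `D i`, indexed by the inputs `x ∈ S ⊆ {0,1}^N`, whose entry at `(x, y)`
is `1` if the strings `x` and `y` differ in the `i`th bit and `0` otherwise. -/
def queryMatrix {N : ℕ} (S : Finset (Fin N → Bool)) (i : Fin N) : Matrix S S ℝ :=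
  Matrix.of fun x y => if x.1 i ≠ y.1 i then 1 else 0

/-- A non-negative adversary matrix for `f : S → T`, with `S ⊆ {0,1}^N`: a nonzero, entrywise
non-negative square matrix indexed by the inputs that vanishes at `(x, y)` whenever
`f x = f y`. -/
structure IsAdversaryMatrix {N : ℕ} {S : Finset (Fin N → Bool)} {T : Type*} (f : S → T)
    (Γ : Matrix S S ℝ) : Prop where
  nonneg : ∀ x y, 0 ≤ Γ x y
  ne_zero : Γ ≠ 0
  eq_zero_of_eq : ∀ x y, f x = f y → Γ x y = 0

/-- The value `‖Γ‖ / max_i ‖Γ ∘ D_i‖` achieved by a matrix `Γ`, where `∘` is the entrywise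
product. -/
noncomputable def adversaryValue {N : ℕ} {S : Finset (Fin N → Bool)} (Γ : Matrix S S ℝ) : ℝ :=
  matSpectralNorm Γ / ⨆ i : Fin N, matSpectralNorm (Matrix.hadamard Γ (queryMatrix S i))

/-- The set of all values achieved by non-negative adversary matrices for `f`. -/
def adversaryValues {N : ℕ} {S : Finset (Fin N → Bool)} {T : Type*} (f : S → T) : Set ℝ :=
  {r | ∃ Γ : Matrix S S ℝ, IsAdversaryMatrix f Γ ∧ adversaryValue Γ = r}

/-- The optimal non-negative adversary bound of `f`. -/
noncomputable def ADV {N : ℕ} {S : Finset (Fin N → Bool)} {T : Type*} (f : S → T) : ℝ :=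
  sSup (adversaryValues f)

/-- The cyclic shift by `k` places of the string of `n` ones followed by `n` zeros. -/
def ospString (n k : ℕ) : Fin (2 * n) → Bool :=
  fun j => decide ((j.1 + k) % (2 * n) < n)

/-- The inputs of the symmetrized ordered search problem: all cyclic shifts of `1ⁿ0ⁿ`. -/
def ospInputs (n : ℕ) : Finset (Fin (2 * n) → Bool) :=
  (Finset.range (2 * n)).image (ospString n)

/-- The symmetrized ordered search problem: identify the input. -/
def OSP (n : ℕ) : ospInputs n → (Fin (2 * n) → Bool) :=
  fun x => x.1

/-- `ξ_i = binom(2i, i) / 4^i`. -/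
noncomputable def xi (i : ℕ) : ℝ :=
  ((2 * i).choose i : ℝ) / 4 ^ i

/-!
Write `S_m = ∑_{i < m} ξ_i ^ 2`. The adversary value of `OSP n` is exactly
`V_n = S_{⌈n/2⌉} + S_{⌊n/2⌋}`, the squared length of the palindrome `u = (ξ_0, ξ_1, …, ξ_1, ξ_0)`
of length `n`. Everything rests on the convolution identity `∑_{a + b = r} ξ_a ξ_b = 1`
(`sum_antidiagonal_xi`), which says that `(1 - z)^{-1/2}` squares to the geometric series.

*Upper bound.* By weak duality (`matSpectralNorm_le_of_weights`) it is enough to give each input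
weights on its bits so that distinct inputs overlap enough on the bits where they differ. Put `u`
on both halves of the cycle, rotated with the input. The overlap of two inputs at distance `d` is
twice an autocorrelation of `u` with `d` terms; as `ξ` decreases, `u_a ≥ ξ_a`, so by symmetry of `u`
the autocorrelation is at least `∑_{a + b = d - 1} ξ_a ξ_b = 1`. This applies to arbitrary
adversary matrices, so no symmetrization is needed.

*Lower bound.* Take a symmetric circulant matrix supported on distances at most `⌈n/2⌉`. After
masking by a query, `u` is required to be a fixed vector, which is a triangular Toeplitz system
`ξ * s = c` for the entries `s`. Since `ξ * ξ = 1`, its solution is the convolution of `ξ` with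
the increments of `c`, and these are non-negative because `ξ` decreases. Schur's test
(`matSpectralNorm_le_one_of_fixed_vector`) bounds the masked matrices by `1`, while convolving with
`ξ` once more gives the row sums `2 ∑ s_j = V_n`.

*Asymptotics.* Wallis' inequalities `1 / (π (k + 1/2)) ≤ ξ_k ^ 2 ≤ 1 / (π k)` show that
`S_m - (1/π) log m` is within `1 / (π m)` of its limit along any subsequence. To find the limit, a
telescoping sum gives the exact identity
`S_K = ∑_{k < K} ξ_k ξ_{k+J} + ∑_{j < J} 2 / (2j + 1) * K ξ_K ξ_{K+j}` (`sum_xi_sq_eq`). For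
`K = J ^ 2` the first sum compares with `(1/π) ∫ dx / √(x (x + J)) ≈ (1/π) (log J + 2 log 2)`, and
the second is asymptotic to `(1/π) ∑_{j < J} 2 / (2j + 1) ≈ (1/π) (log J + γ + 2 log 2)`.
-/

/-! ### Bounds on the spectral norm -/

section SpectralNorm

variable {ι : Type*} [Fintype ι] [DecidableEq ι]

lemma matSpectralNorm_nonneg (A : Matrix ι ι ℝ) : 0 ≤ matSpectralNorm A := norm_nonneg _

lemma sum_mul_mul_le_matSpectralNorm (A : Matrix ι ι ℝ) (a b : ι → ℝ) :
    ∑ x, ∑ y, a x * A x y * b y ≤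
      matSpectralNorm A * (√(∑ x, a x ^ 2) * √(∑ x, b x ^ 2)) := by
  have h := real_inner_le_norm (WithLp.toLp 2 a)
    (Matrix.toEuclideanCLM (𝕜 := ℝ) A (WithLp.toLp 2 b))
  rw [Matrix.inner_toEuclideanCLM] at h
  have h2 := (Matrix.toEuclideanCLM (𝕜 := ℝ) A).le_opNorm (WithLp.toLp 2 b)
  have h3 := h.trans (mul_le_mul_of_nonneg_left h2 (norm_nonneg _))
  simp only [EuclideanSpace.norm_eq, Real.norm_eq_abs, sq_abs] at h3
  have h4 : ∑ x, ∑ y, a x * A x y * b y = a ⬝ᵥ A.mulVec b := by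
    simp only [dotProduct, Matrix.mulVec, Finset.mul_sum, mul_assoc]
  rw [h4]
  refine h3.trans (le_of_eq ?_)
  unfold matSpectralNorm
  ring

lemma matSpectralNorm_le_of_mulVec {A : Matrix ι ι ℝ} {c : ℝ} (hc : 0 ≤ c)
    (h : ∀ b : ι → ℝ, ∑ x, (∑ y, A x y * b y) ^ 2 ≤ c ^ 2 * ∑ x, b x ^ 2) :
    matSpectralNorm A ≤ c := by
  refine ContinuousLinearMap.opNorm_le_bound _ hc fun b => ?_
  refine (sq_le_sq₀ (norm_nonneg _) (by positivity)).mp ?_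
  rw [mul_pow, EuclideanSpace.norm_sq_eq, EuclideanSpace.norm_sq_eq]
  simpa [Matrix.mulVec, dotProduct] using h b.ofLp

lemma matSpectralNorm_le_of_bilin {A : Matrix ι ι ℝ} {c : ℝ} (hc : 0 ≤ c)
    (h : ∀ a b : ι → ℝ,
      ∑ x, ∑ y, a x * A x y * b y ≤ c * (√(∑ x, a x ^ 2) * √(∑ x, b x ^ 2))) :
    matSpectralNorm A ≤ c := by
  refine matSpectralNorm_le_of_mulVec hc fun b => ?_
  have h1 := h (fun x => ∑ y, A x y * b y) b
  have h2 : ∑ x, ∑ y, (∑ z, A x z * b z) * A x y * b y = ∑ x, (∑ y, A x y * b y) ^ 2 := by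
    refine Finset.sum_congr rfl fun x _ => ?_
    rw [sq, Finset.mul_sum]
    exact Finset.sum_congr rfl fun y _ => by ring
  rw [h2] at h1
  set P := ∑ x, (∑ y, A x y * b y) ^ 2
  have hP : 0 ≤ P := Finset.sum_nonneg fun _ _ => sq_nonneg _
  set B := ∑ x, b x ^ 2
  have hB : 0 ≤ B := Finset.sum_nonneg fun _ _ => sq_nonneg _
  have h3 : √P ≤ c * √B := by
    rcases hP.eq_or_lt with h0 | h0
    · rw [← h0]; simp; positivity
    · have hs := Real.sqrt_pos.2 h0
      refine le_of_mul_le_mul_left ?_ hs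
      rw [Real.mul_self_sqrt hP]
      linarith
  calc P = √P ^ 2 := (Real.sq_sqrt hP).symm
    _ ≤ (c * √B) ^ 2 := by gcongr
    _ = c ^ 2 * B := by rw [mul_pow, Real.sq_sqrt hB]

/-- Schur's test: a symmetric non-negative matrix that fixes a positive vector is a
contraction. -/
lemma matSpectralNorm_le_one_of_fixed_vector {A : Matrix ι ι ℝ} (hA : ∀ x y, 0 ≤ A x y)
    (hsymm : ∀ x y, A x y = A y x) {p : ι → ℝ} (hp : ∀ x, 0 < p x)
    (hfix : ∀ x, ∑ y, A x y * p y = p x) : matSpectralNorm A ≤ 1 := by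
  refine matSpectralNorm_le_of_mulVec zero_le_one fun b => ?_
  -- Cauchy-Schwarz with the weights `A x y * p y` on each row.
  have hrow : ∀ x, (∑ y, A x y * b y) ^ 2 ≤ p x * ∑ y, A x y * (b y ^ 2 / p y) := by
    intro x
    have := Finset.sum_sq_le_sum_mul_sum_of_sq_le_mul Finset.univ
      (r := fun y => A x y * b y) (f := fun y => A x y * p y)
      (g := fun y => A x y * (b y ^ 2 / p y))
      (fun y _ => mul_nonneg (hA x y) (hp y).le)
      (fun y _ => mul_nonneg (hA x y) (div_nonneg (sq_nonneg _) (hp y).le))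
      (fun y _ => by have := (hp y).ne'; field_simp; rfl)
    rwa [hfix] at this
  calc ∑ x, (∑ y, A x y * b y) ^ 2 ≤ ∑ x, p x * ∑ y, A x y * (b y ^ 2 / p y) :=
        Finset.sum_le_sum fun x _ => hrow x
    _ = ∑ y, (b y ^ 2 / p y) * ∑ x, A y x * p x := by
        simp only [Finset.mul_sum]
        rw [Finset.sum_comm]
        refine Finset.sum_congr rfl fun y _ => Finset.sum_congr rfl fun x _ => ?_
        rw [hsymm x y]; ring
    _ = 1 ^ 2 * ∑ x, b x ^ 2 := by
        rw [one_pow, one_mul]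
        refine Finset.sum_congr rfl fun y _ => ?_
        rw [hfix, div_mul_cancel₀ _ (hp y).ne']

/-- Testing against the constant vector: a matrix all of whose row sums are `V` has spectral norm
at least `V`. -/
lemma le_matSpectralNorm_of_row_sum [Nonempty ι] {A : Matrix ι ι ℝ} {V : ℝ}
    (h : ∀ x, ∑ y, A x y = V) : V ≤ matSpectralNorm A := by
  have h1 := sum_mul_mul_le_matSpectralNorm A (fun _ => 1) (fun _ => 1)
  simp only [one_mul, mul_one, h, one_pow, Finset.sum_const, Finset.card_univ, nsmul_eq_mul] at h1
  rw [Real.mul_self_sqrt (Nat.cast_nonneg _), mul_comm] at h1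
  exact le_of_mul_le_mul_right h1 (Nat.cast_pos.2 Fintype.card_pos)

end SpectralNorm

/-! ### Weak duality for the adversary bound -/

section Adversary

variable {N : ℕ} {S : Finset (Fin N → Bool)} {T : Type*}

lemma matSpectralNorm_hadamard_le_iSup (Γ : Matrix S S ℝ) (i : Fin N) :
    matSpectralNorm (Matrix.hadamard Γ (queryMatrix S i)) ≤
      ⨆ i : Fin N, matSpectralNorm (Matrix.hadamard Γ (queryMatrix S i)) :=
  le_ciSup (f := fun i : Fin N => matSpectralNorm (Matrix.hadamard Γ (queryMatrix S i)))
    (Set.finite_range _).bddAbove i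

/-- Weak duality for the non-negative adversary bound: non-negative weights `p x i` for which any
two inputs with distinct values have overlap at least `κ` on the bits where they differ, and for
which every input has total squared weight at most `κ * V`, certify the upper bound `V`. -/
theorem matSpectralNorm_le_of_weights {f : S → T} {Γ : Matrix S S ℝ} (hΓ : IsAdversaryMatrix f Γ)
    {p : S → Fin N → ℝ} {κ V : ℝ} (hκ : 0 < κ) (hV : 0 ≤ V)
    (hpair : ∀ x y, f x ≠ f y → κ ≤ ∑ i, if x.1 i ≠ y.1 i then p x i * p y i else 0)
    (hsq : ∀ x, ∑ i, p x i ^ 2 ≤ κ * V) :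
    matSpectralNorm Γ ≤
      V * ⨆ i : Fin N, matSpectralNorm (Matrix.hadamard Γ (queryMatrix S i)) := by
  set m := ⨆ i : Fin N, matSpectralNorm (Matrix.hadamard Γ (queryMatrix S i)) with hm
  have hm0 : 0 ≤ m := Real.iSup_nonneg fun i => matSpectralNorm_nonneg _
  refine matSpectralNorm_le_of_bilin (mul_nonneg hV hm0) fun a b => ?_
  have hmass : ∀ c : S → ℝ, ∑ i, ∑ x, (|c x| * p x i) ^ 2 ≤ κ * V * ∑ x, c x ^ 2 := by
    intro c
    rw [Finset.sum_comm, Finset.mul_sum]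
    refine Finset.sum_le_sum fun x _ => ?_
    simp only [mul_pow, sq_abs, ← Finset.mul_sum]
    rw [mul_comm]
    exact mul_le_mul_of_nonneg_right (hsq x) (sq_nonneg _)
  have h1 : κ * ∑ x, ∑ y, a x * Γ x y * b y ≤
      ∑ x, ∑ y, |a x| * Γ x y * |b y| * ∑ i, if x.1 i ≠ y.1 i then p x i * p y i else 0 := by
    simp only [Finset.mul_sum (a := κ)]
    refine Finset.sum_le_sum fun x _ => Finset.sum_le_sum fun y _ => ?_
    by_cases hxy : f x = f y
    · simp [hΓ.eq_zero_of_eq x y hxy]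
    · have h0 : a x * Γ x y * b y ≤ |a x| * Γ x y * |b y| := by
        refine (le_abs_self _).trans (le_of_eq ?_)
        rw [abs_mul, abs_mul, abs_of_nonneg (hΓ.nonneg x y)]
      have h2 : 0 ≤ |a x| * Γ x y * |b y| :=
        mul_nonneg (mul_nonneg (abs_nonneg _) (hΓ.nonneg x y)) (abs_nonneg _)
      calc κ * (a x * Γ x y * b y) ≤ κ * (|a x| * Γ x y * |b y|) := by gcongr
        _ = |a x| * Γ x y * |b y| * κ := mul_comm _ _
        _ ≤ _ := mul_le_mul_of_nonneg_left (hpair x y hxy) h2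
  have h2 : (∑ x, ∑ y, |a x| * Γ x y * |b y| *
        ∑ i, if x.1 i ≠ y.1 i then p x i * p y i else 0) =
      ∑ i, ∑ x, ∑ y, (|a x| * p x i) * Matrix.hadamard Γ (queryMatrix S i) x y *
        (|b y| * p y i) := by
    simp only [Finset.mul_sum]
    conv_rhs => rw [Finset.sum_comm]
    refine Finset.sum_congr rfl fun x _ => ?_
    conv_rhs => rw [Finset.sum_comm]
    refine Finset.sum_congr rfl fun y _ => Finset.sum_congr rfl fun i _ => ?_
    simp only [Matrix.hadamard_apply, queryMatrix, Matrix.of_apply]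
    split_ifs <;> ring
  have h3 : ∑ i, ∑ x, ∑ y, (|a x| * p x i) * Matrix.hadamard Γ (queryMatrix S i) x y *
        (|b y| * p y i) ≤
      m * (√(κ * V * ∑ x, a x ^ 2) * √(κ * V * ∑ x, b x ^ 2)) := by
    calc _ ≤ ∑ i, m * (√(∑ x, (|a x| * p x i) ^ 2) * √(∑ x, (|b x| * p x i) ^ 2)) := by
          refine Finset.sum_le_sum fun i _ => ?_
          refine (sum_mul_mul_le_matSpectralNorm _ _ _).trans ?_
          exact mul_le_mul_of_nonneg_right (matSpectralNorm_hadamard_le_iSup Γ i) (by positivity)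
      _ = m * ∑ i, √(∑ x, (|a x| * p x i) ^ 2) * √(∑ x, (|b x| * p x i) ^ 2) := by
          rw [Finset.mul_sum]
      _ ≤ m * (√(∑ i, ∑ x, (|a x| * p x i) ^ 2) * √(∑ i, ∑ x, (|b x| * p x i) ^ 2)) := by
          gcongr
          exact Real.sum_sqrt_mul_sqrt_le _ (fun i => Finset.sum_nonneg fun _ _ => sq_nonneg _)
            (fun i => Finset.sum_nonneg fun _ _ => sq_nonneg _)
      _ ≤ _ := by
          gcongr
          · exact hmass a
          · exact hmass b
  have h4 : m * (√(κ * V * ∑ x, a x ^ 2) * √(κ * V * ∑ x, b x ^ 2)) =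
      κ * (V * m * (√(∑ x, a x ^ 2) * √(∑ x, b x ^ 2))) := by
    have hκV : 0 ≤ κ * V := mul_nonneg hκ.le hV
    rw [Real.sqrt_mul hκV, Real.sqrt_mul hκV]
    linear_combination (m * √(∑ x, a x ^ 2) * √(∑ x, b x ^ 2)) * Real.mul_self_sqrt hκV
  refine le_of_mul_le_mul_left ?_ hκ
  rw [← h4]
  exact (h1.trans h2.le).trans h3

end Adversary

/-! ### The normalized central binomial coefficients -/

section Xi

lemma xi_pos (i : ℕ) : 0 < xi i :=
  div_pos (Nat.cast_pos.2 (Nat.choose_pos (by omega))) (by positivity)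

@[simp]
lemma xi_zero : xi 0 = 1 := by simp [xi]

lemma xi_succ (i : ℕ) : ((i : ℝ) + 1) * xi (i + 1) = (i + 1 / 2) * xi i := by
  have h := Nat.succ_mul_centralBinom_succ i
  simp only [Nat.centralBinom] at h
  have h' : ((i : ℝ) + 1) * ((2 * (i + 1)).choose (i + 1) : ℝ) =
      2 * (2 * i + 1) * ((2 * i).choose i : ℝ) := by exact_mod_cast h
  unfold xi
  rw [pow_succ]
  field_simp
  linear_combination 2 * h'

lemma xi_antitone : Antitone xi := by
  refine antitone_nat_of_succ_le fun i => ?_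
  have h := xi_succ i
  have := xi_pos i
  have hi : (0 : ℝ) ≤ i := i.cast_nonneg
  nlinarith

/-- The generating function of `xi` is `(1 - z)^{-1/2}`, so its square is the geometric series. -/
lemma sum_antidiagonal_xi (r : ℕ) :
    ∑ p ∈ Finset.HasAntidiagonal.antidiagonal r, xi p.1 * xi p.2 = 1 := by
  -- Weighting by the first index gives half of `r` times the sum, by symmetry.
  have hsym : ∀ r : ℕ, ∑ p ∈ Finset.HasAntidiagonal.antidiagonal r, (p.1 : ℝ) * (xi p.1 * xi p.2) =
      r / 2 * ∑ p ∈ Finset.HasAntidiagonal.antidiagonal r, xi p.1 * xi p.2 := by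
    intro r
    have h1 : ∑ p ∈ Finset.HasAntidiagonal.antidiagonal r, (p.1 : ℝ) * (xi p.1 * xi p.2) =
        ∑ p ∈ Finset.HasAntidiagonal.antidiagonal r, (p.2 : ℝ) * (xi p.1 * xi p.2) := by
      rw [← Finset.Nat.sum_antidiagonal_swap]
      exact Finset.sum_congr rfl fun p _ => by simp only [Prod.fst_swap, Prod.snd_swap]; ring
    have h2 : ∑ p ∈ Finset.HasAntidiagonal.antidiagonal r, (p.1 : ℝ) * (xi p.1 * xi p.2) +
        ∑ p ∈ Finset.HasAntidiagonal.antidiagonal r, (p.2 : ℝ) * (xi p.1 * xi p.2) =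
        r * ∑ p ∈ Finset.HasAntidiagonal.antidiagonal r, xi p.1 * xi p.2 := by
      rw [← Finset.sum_add_distrib, Finset.mul_sum]
      refine Finset.sum_congr rfl fun p hp => ?_
      rw [← Finset.HasAntidiagonal.mem_antidiagonal.1 hp]
      push_cast
      ring
    linarith
  induction r with
  | zero => simp
  | succ r ih =>
    have h := hsym (r + 1)
    rw [Finset.Nat.sum_antidiagonal_succ] at h
    have h1 : ∑ p ∈ Finset.HasAntidiagonal.antidiagonal r, ((p.1 + 1 : ℕ) : ℝ) * (xi (p.1 + 1) * xi p.2) =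
        (r / 2 + 1 / 2) * ∑ p ∈ Finset.HasAntidiagonal.antidiagonal r, xi p.1 * xi p.2 := by
      rw [add_mul, ← hsym r, Finset.mul_sum, ← Finset.sum_add_distrib]
      refine Finset.sum_congr rfl fun p _ => ?_
      push_cast
      linear_combination xi p.2 * xi_succ p.1
    rw [h1, ih] at h
    push_cast at h
    have hr : ((r : ℝ) + 1) / 2 ≠ 0 := by positivity
    refine mul_left_cancel₀ hr ?_
    linarith

end Xi

/-! ### Wallis' inequalities and exact summation -/

section XiSums

lemma wallis_mul_xi_sq (k : ℕ) : Real.Wallis.W k * ((2 * k + 1) * xi k ^ 2) = 1 := by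
  have h := Nat.choose_mul_factorial_mul_factorial (show k ≤ 2 * k by omega)
  rw [show 2 * k - k = k by omega] at h
  have h' : ((2 * k).choose k : ℝ) * (k.factorial : ℝ) * (k.factorial : ℝ) =
    ((2 * k).factorial : ℝ) := by exact_mod_cast h
  rw [Real.Wallis.W_eq_factorial_ratio, xi, ← h']
  have h1 : ((2 * k).choose k : ℝ) ≠ 0 := (Nat.cast_pos.2 (Nat.choose_pos (by omega))).ne'
  have h2 : (k.factorial : ℝ) ≠ 0 := by positivity
  have h4 : (2 : ℝ) ^ (4 * k) = (4 ^ k) ^ 2 := by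
    rw [← pow_mul, show (4 : ℝ) = 2 ^ 2 by norm_num, ← pow_mul]; ring_nf
  rw [h4]
  field_simp

lemma le_xi_sq (k : ℕ) : 1 / (Real.pi * (k + 1 / 2)) ≤ xi k ^ 2 := by
  have h := wallis_mul_xi_sq k
  have h1 := Real.Wallis.W_le k
  have hx : 0 < (2 * (k : ℝ) + 1) * xi k ^ 2 := by have := xi_pos k; positivity
  rw [div_le_iff₀ (by positivity)]
  nlinarith

lemma xi_sq_le {k : ℕ} (hk : k ≠ 0) : xi k ^ 2 ≤ 1 / (Real.pi * k) := by
  have h := wallis_mul_xi_sq k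
  have h1 := Real.Wallis.le_W k
  have hk' : (1 : ℝ) ≤ k := by exact_mod_cast Nat.one_le_iff_ne_zero.2 hk
  have hx : 0 < (2 * (k : ℝ) + 1) * xi k ^ 2 := by have := xi_pos k; positivity
  have h2 : (2 * (k : ℝ) + 1) / (2 * k + 2) * (Real.pi / 2) * ((2 * k + 1) * xi k ^ 2) ≤ 1 := by
    have := mul_le_mul_of_nonneg_right h1 hx.le
    rwa [h] at this
  have h3 : (2 * (k : ℝ) + 1) / (2 * k + 2) * (2 * k + 1) ≥ 2 * k := by
    rw [ge_iff_le, div_mul_eq_mul_div, le_div_iff₀ (by positivity)]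
    nlinarith
  rw [le_div_iff₀ (by positivity)]
  have h4 : 0 < Real.pi / 2 * xi k ^ 2 := by have := xi_pos k; positivity
  nlinarith

lemma one_div_pi_mul_add_one_le_xi_sq (k : ℕ) : 1 / (Real.pi * (k + 1)) ≤ xi k ^ 2 := by
  refine le_trans ?_ (le_xi_sq k)
  gcongr
  norm_num

/-- The difference of the correlations of `xi` at lags `j` and `j + 1`, summed up to `K`, telescopes to
a closed form. -/
lemma sum_xi_mul_sub (K j : ℕ) :
    ∑ k ∈ Finset.range K, xi k * (xi (k + j) - xi (k + j + 1)) =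
      2 / (2 * j + 1) * (K * xi K * xi (K + j)) := by
  induction K with
  | zero => simp
  | succ K ih =>
    rw [Finset.sum_range_succ, ih]
    have h1 := xi_succ K
    have h2 := xi_succ (K + j)
    have e1 : xi (K + 1) = (K + 1 / 2) * xi K / (K + 1) := by
      rw [eq_div_iff (by positivity)]; linarith
    have e2 : xi (K + j + 1) = (K + j + 1 / 2) * xi (K + j) / (K + j + 1) := by
      rw [eq_div_iff (by positivity)]; push_cast at h2; linarith
    rw [show K + 1 + j = K + j + 1 by ring, e1, e2]
    push_cast
    field_simp
    ring

/-- The correlation of `xi` at lag `0` equals the one at lag `J` plus the `J` closed-form differences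
between consecutive lags. -/
lemma sum_xi_sq_eq (K J : ℕ) :
    ∑ k ∈ Finset.range K, xi k ^ 2 = ∑ k ∈ Finset.range K, xi k * xi (k + J) +
      ∑ j ∈ Finset.range J, 2 / (2 * j + 1) * (K * xi K * xi (K + j)) := by
  induction J with
  | zero => simp [sq]
  | succ J ih =>
    rw [Finset.sum_range_succ, ih, ← sum_xi_mul_sub K J]
    simp only [mul_sub, Finset.sum_sub_distrib, ← add_assoc]
    ring

end XiSums

/-! ### Asymptotics of the sum of squares -/

section Asymptotics

open Filter Topology

/-- The partial sums of `xi ^ 2` minus `log / π` form a Cauchy sequence with rate `1 / (π m)`: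
both `xi m ^ 2` and `log ((m + 1) / m) / π` lie between `1 / (π (m + 1))` and `1 / (π m)`. -/
lemma abs_sum_xi_sq_sub_log_sub_le {m M : ℕ} (hm : 1 ≤ m) (hM : m ≤ M) :
    |(∑ i ∈ Finset.range M, xi i ^ 2 - 1 / Real.pi * Real.log M) -
      (∑ i ∈ Finset.range m, xi i ^ 2 - 1 / Real.pi * Real.log m)| ≤
      1 / Real.pi * (1 / m - 1 / M) := by
  induction M, hM using Nat.le_induction with
  | base => simp
  | succ M hM ih =>
    have hM0 : (0 : ℝ) < M := by exact_mod_cast hm.trans hM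
    have h1 := xi_sq_le (k := M) (by omega)
    have h2 := one_div_pi_mul_add_one_le_xi_sq M
    have h3 : Real.log (M + 1) - Real.log M ≤ 1 / M := by
      rw [← Real.log_div (by positivity) (by positivity)]
      refine (Real.log_le_sub_one_of_pos (by positivity)).trans (le_of_eq ?_)
      field_simp
      ring
    have h4 : 1 / ((M : ℝ) + 1) ≤ Real.log (M + 1) - Real.log M := by
      rw [← Real.log_div (by positivity) (by positivity)]
      refine (le_of_eq ?_).trans (Real.one_sub_inv_le_log_of_pos (by positivity))
      field_simp
      ring
    have hpi : 0 ≤ 1 / Real.pi := by positivity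
    have h3' := mul_le_mul_of_nonneg_left h3 hpi
    have h4' := mul_le_mul_of_nonneg_left h4 hpi
    rw [one_div_mul_one_div] at h3' h4'
    rw [Finset.sum_range_succ]
    push_cast
    rw [abs_le] at ih ⊢
    rw [mul_sub, one_div_mul_one_div, one_div_mul_one_div] at ih ⊢
    rw [mul_sub] at h3' h4'
    constructor <;> linarith [ih.1, ih.2]

/-- The function `x ↦ 2 log (√x + √(x + J))`, a primitive of `1 / √(x (x + J))`. -/
noncomputable def sqrtPrimitive (J x : ℝ) : ℝ := 2 * Real.log (√x + √(x + J))

/-- The increment of the primitive is at least the interval length times the right endpoint value of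
the decreasing integrand. -/
lemma div_le_sqrtPrimitive_sub {J x y : ℝ} (hJ : 0 < J) (hx : 0 ≤ x) (hxy : x < y) :
    (y - x) / (√y * √(y + J)) ≤ sqrtPrimitive J y - sqrtPrimitive J x := by
  have ht := Real.sqrt_pos.2 (hx.trans_lt hxy)
  have ht' := Real.sqrt_pos.2 (show 0 < y + J by linarith)
  have hs' := Real.sqrt_pos.2 (show 0 < x + J by linarith)
  have hs := Real.sqrt_nonneg x
  have e1 := Real.sq_sqrt hx
  have e2 := Real.sq_sqrt (hx.trans hxy.le)
  have e3 := Real.sq_sqrt (show 0 ≤ x + J by linarith)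
  have e4 := Real.sq_sqrt (show 0 ≤ y + J by linarith)
  have e5 := Real.sqrt_le_sqrt hxy.le
  have e6 := Real.sqrt_le_sqrt (show x + J ≤ y + J by linarith)
  unfold sqrtPrimitive
  set s := √x
  set t := √y
  set s' := √(x + J)
  set t' := √(y + J)
  rw [← mul_sub, ← Real.log_div (by positivity) (by positivity)]
  have h := Real.one_sub_inv_le_log_of_pos (show 0 < (t + t') / (s + s') by positivity)
  refine le_trans ?_ (mul_le_mul_of_nonneg_left h zero_le_two)
  rw [inv_div, one_sub_div (by positivity), mul_div_assoc', div_le_div_iff₀ (by positivity)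
    (by positivity)]
  -- `y - x = (t - s) (t + s)` with `s ≤ t`, and likewise for the other pair of roots.
  have h1 : y - x ≤ 2 * t * (t - s) := by nlinarith
  have h2 : y - x ≤ 2 * t' * (t' - s') := by nlinarith
  nlinarith [mul_le_mul_of_nonneg_left h1 ht'.le, mul_le_mul_of_nonneg_left h2 ht.le]

lemma sqrtPrimitive_sub_le_div {J x y : ℝ} (hJ : 0 < J) (hx : 0 < x) (hxy : x < y) :
    sqrtPrimitive J y - sqrtPrimitive J x ≤ (y - x) / (√x * √(x + J)) := by
  have ht := Real.sqrt_pos.2 (hx.trans hxy)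
  have ht' := Real.sqrt_pos.2 (show 0 < y + J by linarith)
  have hs' := Real.sqrt_pos.2 (show 0 < x + J by linarith)
  have hs := Real.sqrt_pos.2 hx
  have e1 := Real.sq_sqrt hx.le
  have e2 := Real.sq_sqrt (hx.trans hxy).le
  have e3 := Real.sq_sqrt (show 0 ≤ x + J by linarith)
  have e4 := Real.sq_sqrt (show 0 ≤ y + J by linarith)
  have e5 := Real.sqrt_le_sqrt hxy.le
  have e6 := Real.sqrt_le_sqrt (show x + J ≤ y + J by linarith)
  unfold sqrtPrimitive
  set s := √x
  set t := √y
  set s' := √(x + J)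
  set t' := √(y + J)
  rw [← mul_sub, ← Real.log_div (by positivity) (by positivity)]
  have h := Real.log_le_sub_one_of_pos (show 0 < (t + t') / (s + s') by positivity)
  refine (mul_le_mul_of_nonneg_left h zero_le_two).trans ?_
  rw [div_sub_one (by positivity), mul_div_assoc', div_le_div_iff₀ (by positivity)
    (by positivity)]
  -- `y - x = (t - s) (t + s)` with `s ≤ t`, and likewise for the other pair of roots.
  have h1 : 2 * s * (t - s) ≤ y - x := by nlinarith
  have h2 : 2 * s' * (t' - s') ≤ y - x := by nlinarith
  nlinarith [mul_le_mul_of_nonneg_left h1 hs'.le, mul_le_mul_of_nonneg_left h2 hs.le]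

lemma xi_le_inv_sqrt {k : ℕ} (hk : k ≠ 0) : xi k ≤ 1 / (√Real.pi * √k) := by
  rw [← Real.sqrt_mul Real.pi_pos.le, ← Real.sqrt_one, ← Real.sqrt_div zero_le_one]
  exact Real.le_sqrt_of_sq_le (xi_sq_le hk)

lemma inv_sqrt_le_xi (k : ℕ) : 1 / (√Real.pi * √(k + 1)) ≤ xi k := by
  rw [← Real.sqrt_mul Real.pi_pos.le, ← Real.sqrt_one, ← Real.sqrt_div zero_le_one, Real.sqrt_one]
  exact Real.sqrt_le_iff.2 ⟨(xi_pos k).le, one_div_pi_mul_add_one_le_xi_sq k⟩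

lemma sum_xi_mul_xi_add_le {J : ℕ} (hJ : 0 < J) (K : ℕ) :
    ∑ k ∈ Finset.range (K + 1), xi k * xi (k + J) ≤
      xi J + 1 / Real.pi * (sqrtPrimitive J K - sqrtPrimitive J 0) := by
  have hJ' : (0 : ℝ) < J := by exact_mod_cast hJ
  induction K with
  | zero => simp
  | succ K ih =>
    rw [Finset.sum_range_succ]
    have h := div_le_sqrtPrimitive_sub hJ' (Nat.cast_nonneg K) (lt_add_one (K : ℝ))
    have h1 := xi_le_inv_sqrt (k := K + 1) (by omega)
    have h2 := xi_le_inv_sqrt (k := K + 1 + J) (by omega)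
    have h3 := mul_le_mul h1 h2 (xi_pos _).le (by positivity)
    have h4 : 1 / (√Real.pi * √((K + 1 : ℕ) : ℝ)) * (1 / (√Real.pi * √((K + 1 + J : ℕ) : ℝ))) =
        1 / Real.pi * (((K : ℝ) + 1 - K) / (√((K : ℝ) + 1) * √((K : ℝ) + 1 + J))) := by
      push_cast
      rw [add_sub_cancel_left, one_div_mul_one_div, one_div_mul_one_div]
      congr 1
      linear_combination (√((K : ℝ) + 1) * √((K : ℝ) + 1 + J)) * Real.mul_self_sqrt Real.pi_pos.le
    rw [h4] at h3
    have h5 := mul_le_mul_of_nonneg_left h (show 0 ≤ 1 / Real.pi by positivity)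
    push_cast
    linarith

lemma le_sum_xi_mul_xi_add {J : ℕ} (hJ : 0 < J) (K : ℕ) :
    1 / Real.pi * (sqrtPrimitive J (K + 1) - sqrtPrimitive J 1) ≤
      ∑ k ∈ Finset.range K, xi k * xi (k + J) := by
  have hJ' : (0 : ℝ) < J := by exact_mod_cast hJ
  induction K with
  | zero => simp
  | succ K ih =>
    rw [Finset.sum_range_succ]
    have h := sqrtPrimitive_sub_le_div hJ' (show (0 : ℝ) < K + 1 by positivity)
      (lt_add_one ((K : ℝ) + 1))
    have h1 := inv_sqrt_le_xi K
    have h2 := inv_sqrt_le_xi (K + J)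
    have h3 := mul_le_mul h1 h2 (by positivity) (xi_pos _).le
    have h4 : 1 / (√Real.pi * √((K : ℝ) + 1)) * (1 / (√Real.pi * √((K + J : ℕ) + 1 : ℝ))) =
        1 / Real.pi * (((K : ℝ) + 1 + 1 - (K + 1)) / (√((K : ℝ) + 1) * √((K : ℝ) + 1 + J))) := by
      push_cast
      rw [add_sub_cancel_left, one_div_mul_one_div, one_div_mul_one_div,
        add_right_comm (K : ℝ) J 1]
      congr 1
      linear_combination (√((K : ℝ) + 1) * √((K : ℝ) + 1 + J)) * Real.mul_self_sqrt Real.pi_pos.le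
    rw [h4] at h3
    have h5 := mul_le_mul_of_nonneg_left h (show 0 ≤ 1 / Real.pi by positivity)
    push_cast
    linarith

lemma sum_odd_reciprocals_eq (J : ℕ) :
    ∑ j ∈ Finset.range J, 2 / (2 * (j : ℝ) + 1) = 2 * harmonic (2 * J) - harmonic J := by
  induction J with
  | zero => simp
  | succ J ih =>
    rw [Finset.sum_range_succ, ih, show 2 * (J + 1) = 2 * J + 1 + 1 by ring, harmonic_succ,
      harmonic_succ, harmonic_succ]
    push_cast
    field_simp
    ring

lemma tendsto_sum_odd_reciprocals :
    Tendsto (fun J : ℕ => ∑ j ∈ Finset.range J, 2 / (2 * (j : ℝ) + 1) - Real.log J) atTop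
      (𝓝 (Real.eulerMascheroniConstant + 2 * Real.log 2)) := by
  have h1 := Real.tendsto_harmonic_sub_log
  have h2 := h1.comp (tendsto_id.const_mul_atTop' (show 0 < 2 by norm_num))
  have h3 := ((h2.const_mul 2).sub h1).add_const (2 * Real.log 2)
  rw [show 2 * Real.eulerMascheroniConstant - Real.eulerMascheroniConstant + 2 * Real.log 2 =
    Real.eulerMascheroniConstant + 2 * Real.log 2 by ring] at h3
  refine h3.congr' ?_
  filter_upwards [eventually_gt_atTop 0] with J hJ
  have hJ' : (J : ℝ) ≠ 0 := by exact_mod_cast hJ.ne'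
  simp only [Function.comp, id]
  rw [sum_odd_reciprocals_eq]
  push_cast
  rw [Real.log_mul two_ne_zero hJ']
  ring

lemma sqrtPrimitive_zero_right (J : ℕ) : sqrtPrimitive J 0 = Real.log J := by
  unfold sqrtPrimitive
  rw [Real.sqrt_zero, zero_add, zero_add, Real.log_sqrt (Nat.cast_nonneg J)]
  ring

lemma tendsto_sqrt_one_add_inv : Tendsto (fun J : ℕ => √(1 + (J : ℝ)⁻¹)) atTop (𝓝 1) := by
  have := (tendsto_inv_atTop_nhds_zero_nat (𝕜 := ℝ)).const_add 1
  simpa using this.sqrt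

lemma tendsto_sqrtPrimitive_sq :
    Tendsto (fun J : ℕ => sqrtPrimitive J ((J : ℝ) ^ 2) - 2 * Real.log J) atTop
      (𝓝 (2 * Real.log 2)) := by
  have h := ((tendsto_sqrt_one_add_inv.const_add 1).log (by norm_num)).const_mul 2
  rw [show (1 : ℝ) + 1 = 2 by norm_num] at h
  refine h.congr' ?_
  filter_upwards [eventually_gt_atTop 0] with J hJ
  have hJ' : (0 : ℝ) < J := by exact_mod_cast hJ
  unfold sqrtPrimitive
  rw [show (J : ℝ) ^ 2 + J = J ^ 2 * (1 + (J : ℝ)⁻¹) by field_simp, Real.sqrt_mul (by positivity),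
    Real.sqrt_sq hJ'.le, show (J : ℝ) + J * √(1 + (J : ℝ)⁻¹) = J * (1 + √(1 + (J : ℝ)⁻¹)) by ring,
    Real.log_mul hJ'.ne' (by positivity)]
  ring

lemma tendsto_sqrtPrimitive_one :
    Tendsto (fun J : ℕ => sqrtPrimitive J 1 - Real.log J) atTop (𝓝 0) := by
  have h0 : Tendsto (fun J : ℕ => √((J : ℝ)⁻¹)) atTop (𝓝 0) := by
    simpa using (tendsto_inv_atTop_nhds_zero_nat (𝕜 := ℝ)).sqrt
  have h := ((h0.add tendsto_sqrt_one_add_inv).log (by norm_num)).const_mul 2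
  rw [zero_add, Real.log_one, mul_zero] at h
  refine h.congr' ?_
  filter_upwards [eventually_gt_atTop 0] with J hJ
  have hJ' : (0 : ℝ) < J := by exact_mod_cast hJ
  unfold sqrtPrimitive
  have e1 : √(1 : ℝ) = √(J : ℝ) * √((J : ℝ)⁻¹) := by
    rw [← Real.sqrt_mul hJ'.le, mul_inv_cancel₀ hJ'.ne']
  have e2 : √(1 + (J : ℝ)) = √(J : ℝ) * √(1 + (J : ℝ)⁻¹) := by
    rw [← Real.sqrt_mul hJ'.le]; congr 1; field_simp; ring
  rw [e1, e2, ← mul_add, Real.log_mul (Real.sqrt_pos.2 hJ').ne' (by positivity),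
    Real.log_sqrt hJ'.le]
  ring

lemma tendsto_xi : Tendsto xi atTop (𝓝 0) := by
  have h0 : Tendsto (fun J : ℕ => √((J : ℝ)⁻¹)) atTop (𝓝 0) := by
    simpa using (tendsto_inv_atTop_nhds_zero_nat (𝕜 := ℝ)).sqrt
  refine squeeze_zero' (Eventually.of_forall fun k => (xi_pos k).le) ?_ h0
  filter_upwards [eventually_gt_atTop 0] with k hk
  have hk' : (0 : ℝ) < k := by exact_mod_cast hk
  refine Real.le_sqrt_of_sq_le ((xi_sq_le hk.ne').trans ?_)
  rw [← one_div]
  refine one_div_le_one_div_of_le hk' ?_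
  have := Real.pi_gt_three
  nlinarith

/-- The upper estimate of `sum_xi_sq_eq` at `K = J ^ 2`, where `K * ξ_K * ξ_{K+j} ≤ 1 / π`. -/
lemma sum_xi_sq_upper {J : ℕ} (hJ : 0 < J) :
    ∑ k ∈ Finset.range (J ^ 2), xi k ^ 2 ≤
      xi J + 1 / Real.pi * (sqrtPrimitive J ((J : ℝ) ^ 2) - Real.log J) +
        1 / Real.pi * ∑ j ∈ Finset.range J, 2 / (2 * (j : ℝ) + 1) := by
  rw [sum_xi_sq_eq (J ^ 2) J, ← sqrtPrimitive_zero_right J]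
  refine add_le_add ?_ ?_
  · have h := sum_xi_mul_xi_add_le hJ (J ^ 2)
    rw [Finset.sum_range_succ] at h
    have := mul_pos (xi_pos (J ^ 2)) (xi_pos (J ^ 2 + J))
    push_cast at h
    linarith
  · rw [Finset.mul_sum]
    refine Finset.sum_le_sum fun j _ => ?_
    rw [mul_comm (1 / Real.pi)]
    refine mul_le_mul_of_nonneg_left ?_ (by positivity)
    have hK : J ^ 2 ≠ 0 := by positivity
    have hK' : (0 : ℝ) < ((J ^ 2 : ℕ) : ℝ) := by positivity
    have h1 := xi_sq_le hK
    have h2 : xi (J ^ 2 + j) ≤ xi (J ^ 2) := xi_antitone (Nat.le_add_right _ _)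
    calc ((J ^ 2 : ℕ) : ℝ) * xi (J ^ 2) * xi (J ^ 2 + j) ≤
          ((J ^ 2 : ℕ) : ℝ) * xi (J ^ 2) * xi (J ^ 2) := by
            have := xi_pos (J ^ 2); gcongr
      _ = ((J ^ 2 : ℕ) : ℝ) * xi (J ^ 2) ^ 2 := by ring
      _ ≤ ((J ^ 2 : ℕ) : ℝ) * (1 / (Real.pi * ((J ^ 2 : ℕ) : ℝ))) := by gcongr
      _ = 1 / Real.pi := by field_simp

/-- The lower estimate of `sum_xi_sq_eq` at `K = J ^ 2`, where `K * ξ_K * ξ_{K+j}` is at least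
`K / (π (K + J + 1)) ≥ (1 - 1 / J) / π` for `j ≤ J`. -/
lemma sum_xi_sq_lower {J : ℕ} (hJ : 0 < J) :
    1 / Real.pi * (sqrtPrimitive J ((J : ℝ) ^ 2) - sqrtPrimitive J 1) +
        1 / Real.pi * ((1 - 1 / J) * ∑ j ∈ Finset.range J, 2 / (2 * (j : ℝ) + 1)) ≤
      ∑ k ∈ Finset.range (J ^ 2), xi k ^ 2 := by
  have hJ' : (0 : ℝ) < J := by exact_mod_cast hJ
  rw [sum_xi_sq_eq (J ^ 2) J]
  refine add_le_add ?_ ?_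
  · have h := le_sum_xi_mul_xi_add hJ (J ^ 2)
    refine le_trans ?_ h
    push_cast
    have h2 := div_le_sqrtPrimitive_sub hJ' (sq_nonneg (J : ℝ)) (lt_add_one ((J : ℝ) ^ 2))
    have h3 : sqrtPrimitive J ((J : ℝ) ^ 2) ≤ sqrtPrimitive J ((J : ℝ) ^ 2 + 1) := by
      refine sub_nonneg.1 (le_trans ?_ h2)
      rw [add_sub_cancel_left]
      positivity
    gcongr
  · rw [Finset.mul_sum, Finset.mul_sum]
    refine Finset.sum_le_sum fun j hj => ?_
    have hj' := Finset.mem_range.1 hj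
    have h1 := one_div_pi_mul_add_one_le_xi_sq (J ^ 2 + J)
    have h2 : xi (J ^ 2 + J) ≤ xi (J ^ 2) := xi_antitone (Nat.le_add_right _ _)
    have h3 : xi (J ^ 2 + J) ≤ xi (J ^ 2 + j) := xi_antitone (by omega)
    have h4 : 1 / Real.pi * (1 - 1 / J) ≤
        ((J ^ 2 : ℕ) : ℝ) * xi (J ^ 2) * xi (J ^ 2 + j) := by
      calc 1 / Real.pi * (1 - 1 / J) ≤
            (J : ℝ) ^ 2 * (1 / (Real.pi * ((J ^ 2 + J : ℕ) + 1))) := by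
              push_cast
              rw [one_sub_div hJ'.ne', one_div_mul_eq_div, div_div, mul_one_div,
                div_le_div_iff₀ (by positivity) (by positivity)]
              have := Real.pi_pos
              have h5 : ((J : ℝ) - 1) * (J ^ 2 + J + 1) ≤ J ^ 2 * J := by nlinarith
              nlinarith
        _ ≤ (J : ℝ) ^ 2 * xi (J ^ 2 + J) ^ 2 := by gcongr
        _ = (J : ℝ) ^ 2 * xi (J ^ 2 + J) * xi (J ^ 2 + J) := by ring
        _ ≤ (J : ℝ) ^ 2 * xi (J ^ 2) * xi (J ^ 2 + j) := by
              have := xi_pos (J ^ 2 + J)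
              have := xi_pos (J ^ 2)
              gcongr
        _ = _ := by push_cast; ring
    have h5 : (0 : ℝ) ≤ 2 / (2 * (j : ℝ) + 1) := by positivity
    calc 1 / Real.pi * ((1 - 1 / J) * (2 / (2 * (j : ℝ) + 1))) =
          2 / (2 * (j : ℝ) + 1) * (1 / Real.pi * (1 - 1 / J)) := by ring
      _ ≤ _ := mul_le_mul_of_nonneg_left h4 h5

lemma tendsto_inv_mul_sum_odd_reciprocals :
    Tendsto (fun J : ℕ => 1 / (J : ℝ) * ∑ j ∈ Finset.range J, 2 / (2 * (j : ℝ) + 1)) atTop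
      (𝓝 0) := by
  have h1 : Tendsto (fun J : ℕ => Real.log J / (J : ℝ)) atTop (𝓝 0) := by
    have := (Real.isLittleO_log_id_atTop.tendsto_div_nhds_zero).comp
      (tendsto_natCast_atTop_atTop (R := ℝ))
    exact this
  have h2 := (tendsto_inv_atTop_nhds_zero_nat (𝕜 := ℝ)).mul tendsto_sum_odd_reciprocals
  rw [zero_mul] at h2
  have h3 := h1.add h2
  rw [add_zero] at h3
  refine h3.congr fun J => ?_
  simp only [div_eq_mul_inv]
  ring

/-- The constant in the asymptotics, found along the squares `J ^ 2`, for which both sums in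
`sum_xi_sq_eq` can be estimated up to `o(1)`. -/
lemma tendsto_sum_xi_sq_subseq :
    Tendsto (fun J : ℕ => ∑ k ∈ Finset.range (J ^ 2), xi k ^ 2 -
      1 / Real.pi * Real.log ((J ^ 2 : ℕ) : ℝ)) atTop
      (𝓝 (1 / Real.pi * (Real.eulerMascheroniConstant + Real.log 16))) := by
  have hlog : Real.log 16 = 4 * Real.log 2 := by
    rw [show (16 : ℝ) = 2 ^ 4 by norm_num, Real.log_pow]; norm_num
  have hP := tendsto_sqrtPrimitive_sq
  have hH := tendsto_sum_odd_reciprocals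
  have hup := tendsto_xi.add ((hP.add hH).const_mul (1 / Real.pi))
  have hlow := (((hP.sub tendsto_sqrtPrimitive_one).add hH).sub
    tendsto_inv_mul_sum_odd_reciprocals).const_mul (1 / Real.pi)
  rw [show 0 + 1 / Real.pi * (2 * Real.log 2 + (Real.eulerMascheroniConstant + 2 * Real.log 2)) =
    1 / Real.pi * (Real.eulerMascheroniConstant + Real.log 16) by rw [hlog]; ring] at hup
  rw [show 1 / Real.pi * (2 * Real.log 2 - 0 +
    (Real.eulerMascheroniConstant + 2 * Real.log 2) - 0) =
    1 / Real.pi * (Real.eulerMascheroniConstant + Real.log 16) by rw [hlog]; ring] at hlow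
  refine tendsto_of_tendsto_of_tendsto_of_le_of_le' hlow hup ?_ ?_
  · filter_upwards [eventually_gt_atTop 0] with J hJ
    have h := sum_xi_sq_lower hJ
    push_cast
    rw [Real.log_pow]
    push_cast
    linarith
  · filter_upwards [eventually_gt_atTop 0] with J hJ
    have h := sum_xi_sq_upper hJ
    push_cast
    rw [Real.log_pow]
    push_cast
    linarith

theorem abs_sum_xi_sq_sub_le {m : ℕ} (hm : 1 ≤ m) :
    |∑ i ∈ Finset.range m, xi i ^ 2 -
      1 / Real.pi * (Real.log m + Real.eulerMascheroniConstant + Real.log 16)| ≤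
      1 / Real.pi * (1 / m) := by
  have h1 := ((tendsto_sum_xi_sq_subseq.sub_const
    (∑ i ∈ Finset.range m, xi i ^ 2 - 1 / Real.pi * Real.log m)).abs)
  rw [abs_sub_comm]
  have h2 : |1 / Real.pi * (Real.eulerMascheroniConstant + Real.log 16) -
      (∑ i ∈ Finset.range m, xi i ^ 2 - 1 / Real.pi * Real.log m)| ≤ 1 / Real.pi * (1 / m) := by
    refine le_of_tendsto h1 ?_
    filter_upwards [eventually_ge_atTop m] with J hJ
    have hle : m ≤ J ^ 2 := hJ.trans (Nat.le_self_pow two_ne_zero J)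
    refine (abs_sum_xi_sq_sub_log_sub_le hm hle).trans ?_
    gcongr
    have : (0 : ℝ) ≤ 1 / ((J ^ 2 : ℕ) : ℝ) := by positivity
    linarith
  convert h2 using 2
  ring

end Asymptotics

/-! ### The weight profile -/

section OrderedSearch

/-- The dual weight profile on `{0, …, n - 1}`: the palindrome `ξ_0, ξ_1, …, ξ_1, ξ_0`. -/
noncomputable def ospProfile (n a : ℕ) : ℝ := xi (min a (n - 1 - a))

/-- The squared length of the weight profile, which is the adversary value of `OSP n`. -/
noncomputable def ospValue (n : ℕ) : ℝ := ∑ a ∈ Finset.range n, ospProfile n a ^ 2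

lemma ospProfile_pos (n a : ℕ) : 0 < ospProfile n a := xi_pos _

lemma xi_le_ospProfile (n a : ℕ) : xi a ≤ ospProfile n a := xi_antitone (min_le_left _ _)

lemma ospProfile_reflect {n a : ℕ} (ha : a < n) : ospProfile n (n - 1 - a) = ospProfile n a := by
  unfold ospProfile
  congr 1
  omega

lemma ospValue_eq (n : ℕ) : ospValue n =
    ∑ i ∈ Finset.range ((n + 1) / 2), xi i ^ 2 + ∑ i ∈ Finset.range (n / 2), xi i ^ 2 := by
  unfold ospValue
  nth_rewrite 1 [show n = (n + 1) / 2 + n / 2 by omega]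
  rw [Finset.sum_range_add, ← Finset.sum_range_reflect (fun i => xi i ^ 2) (n / 2)]
  unfold ospProfile
  congr 1
  · refine Finset.sum_congr rfl fun a ha => ?_
    have := Finset.mem_range.1 ha
    congr 2
    omega
  · refine Finset.sum_congr rfl fun a ha => ?_
    have := Finset.mem_range.1 ha
    congr 2
    omega

/-- The shift at distance `d` overlaps the profile in an autocorrelation of length `d`, bounded
below by a convolution of `xi` with itself. -/
lemma one_le_sum_ospProfile {n d : ℕ} (hd : 1 ≤ d) (hdn : d ≤ n) :
    1 ≤ ∑ b ∈ Finset.range d, ospProfile n (n - d + b) * ospProfile n b := by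
  obtain ⟨r, rfl⟩ : ∃ r, d = r + 1 := ⟨d - 1, by omega⟩
  rw [← sum_antidiagonal_xi r, Finset.Nat.sum_antidiagonal_eq_sum_range_succ_mk]
  refine Finset.sum_le_sum fun b hb => ?_
  have hb' := Finset.mem_range.1 hb
  rw [mul_comm, ← ospProfile_reflect (n := n) (a := n - (r + 1) + b) (by omega),
    show n - 1 - (n - (r + 1) + b) = r - b by omega]
  exact mul_le_mul (xi_le_ospProfile n (r - b)) (xi_le_ospProfile n b) (xi_pos _).le
    (ospProfile_pos _ _).le

/-! ### Bits and weights on the cycle -/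

variable {n : ℕ}

/-- The bit of the string `1ⁿ0ⁿ`, read cyclically, at a position. -/
def ospBit (n : ℕ) (c : ZMod (2 * n)) : Prop := c.val < n

instance (c : ZMod (2 * n)) : Decidable (ospBit n c) := inferInstanceAs (Decidable (c.val < n))

/-- The weight profile extended to the cycle with period `n`. -/
noncomputable def ospWeight (n : ℕ) (c : ZMod (2 * n)) : ℝ := ospProfile n (c.val % n)

lemma ospWeight_pos (c : ZMod (2 * n)) : 0 < ospWeight n c := ospProfile_pos _ _

lemma val_natCast_of_lt_half {a : ℕ} (ha : a < n) : (a : ZMod (2 * n)).val = a :=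
  ZMod.val_natCast_of_lt (by omega)

lemma val_natCast_add_half {a : ℕ} (ha : a < n) : ((a : ZMod (2 * n)) + n).val = a + n := by
  rw [← Nat.cast_add]
  exact ZMod.val_natCast_of_lt (by omega)

lemma half_add_half : (n : ZMod (2 * n)) + n = 0 := by
  rw [← Nat.cast_add, ← two_mul, ZMod.natCast_self]

lemma ospBit_natCast {a : ℕ} (ha : a < n) : ospBit n (a : ZMod (2 * n)) := by
  unfold ospBit
  rwa [val_natCast_of_lt_half ha]

lemma not_ospBit_natCast_add {a : ℕ} (ha : a < n) : ¬ ospBit n ((a : ZMod (2 * n)) + n) := by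
  unfold ospBit
  rw [val_natCast_add_half ha]
  omega

lemma ospWeight_natCast {a : ℕ} (ha : a < n) :
    ospWeight n (a : ZMod (2 * n)) = ospProfile n a := by
  unfold ospWeight
  rw [val_natCast_of_lt_half ha, Nat.mod_eq_of_lt ha]

lemma ospWeight_natCast_add {a : ℕ} (ha : a < n) :
    ospWeight n ((a : ZMod (2 * n)) + n) = ospProfile n a := by
  unfold ospWeight
  rw [val_natCast_add_half ha, Nat.add_mod_right, Nat.mod_eq_of_lt ha]

/-- The weight seen across the bit boundary when moving forward by `d`. -/
lemma ite_ospBit_add {a d : ℕ} (ha : a < n) (hd : d ≤ n) :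
    (if ospBit n (a : ZMod (2 * n)) ↔ ospBit n ((a : ZMod (2 * n)) + d) then 0
      else ospWeight n ((a : ZMod (2 * n)) + d)) =
    if n ≤ a + d then ospProfile n (a + d - n) else 0 := by
  by_cases h : n ≤ a + d
  · have e : (a : ZMod (2 * n)) + d = ((a + d - n : ℕ) : ZMod (2 * n)) + n := by
      rw [← Nat.cast_add, ← Nat.cast_add, Nat.sub_add_cancel h]
    have hlt : a + d - n < n := by omega
    rw [e, if_pos h, ospWeight_natCast_add hlt, if_neg]
    simp [ospBit_natCast ha, not_ospBit_natCast_add hlt]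
  · have e : (a : ZMod (2 * n)) + d = ((a + d : ℕ) : ZMod (2 * n)) := by rw [← Nat.cast_add]
    rw [e, if_neg h, if_pos]
    exact iff_of_true (ospBit_natCast ha) (ospBit_natCast (not_le.1 h))

/-- The weight seen across the bit boundary when moving backward by `d`. -/
lemma ite_ospBit_sub {a d : ℕ} (ha : a < n) (hd : d ≤ n) :
    (if ospBit n (a : ZMod (2 * n)) ↔ ospBit n ((a : ZMod (2 * n)) - d) then 0
      else ospWeight n ((a : ZMod (2 * n)) - d)) =
    if a < d then ospProfile n (n + a - d) else 0 := by
  by_cases h : a < d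
  · have hlt : n + a - d < n := by omega
    have e : (a : ZMod (2 * n)) - d = ((n + a - d : ℕ) : ZMod (2 * n)) + n := by
      rw [sub_eq_iff_eq_add, add_right_comm, ← Nat.cast_add, Nat.sub_add_cancel (by omega),
        Nat.cast_add, add_right_comm, half_add_half, zero_add]
    rw [e, if_pos h, ospWeight_natCast_add hlt, if_neg]
    simp [ospBit_natCast ha, not_ospBit_natCast_add hlt]
  · have e : (a : ZMod (2 * n)) - d = ((a - d : ℕ) : ZMod (2 * n)) := by
      rw [Nat.cast_sub (not_lt.1 h)]
    have hlt : a - d < n := by omega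
    rw [e, if_neg h, if_pos]
    exact iff_of_true (ospBit_natCast ha) (ospBit_natCast hlt)

variable [NeZero n]

lemma exists_natCast_or_add_half (c : ZMod (2 * n)) :
    ∃ a < n, c = (a : ZMod (2 * n)) ∨ c = (a : ZMod (2 * n)) + n := by
  have hc := ZMod.val_lt c
  by_cases h : c.val < n
  · exact ⟨c.val, h, Or.inl (ZMod.natCast_zmod_val c).symm⟩
  · refine ⟨c.val - n, by omega, Or.inr ?_⟩
    rw [← Nat.cast_add, Nat.sub_add_cancel (not_lt.1 h), ZMod.natCast_zmod_val]

/-- A half turn flips the bit. -/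
lemma ospBit_add_half (c : ZMod (2 * n)) : ospBit n (c + n) ↔ ¬ ospBit n c := by
  obtain ⟨a, ha, rfl | rfl⟩ := exists_natCast_or_add_half c
  · simp [ospBit_natCast ha, not_ospBit_natCast_add ha]
  · rw [add_assoc, half_add_half, add_zero]
    simp [ospBit_natCast ha, not_ospBit_natCast_add ha]

lemma ospWeight_add_half (c : ZMod (2 * n)) : ospWeight n (c + n) = ospWeight n c := by
  obtain ⟨a, ha, rfl | rfl⟩ := exists_natCast_or_add_half c
  · rw [ospWeight_natCast ha, ospWeight_natCast_add ha]
  · rw [add_assoc, half_add_half, add_zero, ospWeight_natCast ha, ospWeight_natCast_add ha]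

lemma sum_zmod_eq_sum_range (F : ZMod (2 * n) → ℝ) :
    ∑ c, F c = ∑ a ∈ Finset.range (2 * n), F a := by
  refine Finset.sum_nbij' ZMod.val (fun a => (a : ZMod (2 * n))) ?_ ?_ ?_ ?_ ?_
  · intro c _; exact Finset.mem_range.2 (ZMod.val_lt c)
  · intro a _; exact Finset.mem_univ _
  · intro c _; exact ZMod.natCast_zmod_val c
  · intro a ha; exact ZMod.val_natCast_of_lt (Finset.mem_range.1 ha)
  · intro c _; rw [ZMod.natCast_zmod_val]

lemma sum_fin_eq_sum_zmod (F : ZMod (2 * n) → ℝ) :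
    ∑ i : Fin (2 * n), F (i.1 : ZMod (2 * n)) = ∑ c, F c := by
  rw [sum_zmod_eq_sum_range, Fin.sum_univ_eq_sum_range (fun a => F (a : ZMod (2 * n)))]

lemma sum_zmod_eq_two_mul_of_periodic {F : ZMod (2 * n) → ℝ} (hF : ∀ c, F (c + n) = F c) :
    ∑ c, F c = 2 * ∑ a ∈ Finset.range n, F a := by
  have hrange : Finset.range (2 * n) = Finset.range (n + n) := by rw [two_mul]
  rw [sum_zmod_eq_sum_range, hrange, Finset.sum_range_add, two_mul (∑ a ∈ Finset.range n, F a)]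
  congr 1
  refine Finset.sum_congr rfl fun a _ => ?_
  rw [Nat.cast_add, add_comm, hF]

/-- Dual feasibility of the weights, for shifts at distance at most `n`. -/
lemma two_le_sum_ospWeight_natCast {d : ℕ} (hd : 1 ≤ d) (hdn : d ≤ n) :
    2 ≤ ∑ c : ZMod (2 * n),
      if ospBit n c ↔ ospBit n (c + d) then 0 else ospWeight n c * ospWeight n (c + d) := by
  have hper : ∀ c : ZMod (2 * n),
      (if ospBit n (c + n) ↔ ospBit n (c + n + d) then 0
        else ospWeight n (c + n) * ospWeight n (c + n + d)) =
      if ospBit n c ↔ ospBit n (c + d) then 0 else ospWeight n c * ospWeight n (c + d) := by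
    intro c
    rw [add_right_comm c (n : ZMod (2 * n)), ospWeight_add_half, ospWeight_add_half]
    simp only [ospBit_add_half, not_iff_not]
  rw [sum_zmod_eq_two_mul_of_periodic hper]
  have h1 : ∀ a ∈ Finset.range n,
      (if ospBit n (a : ZMod (2 * n)) ↔ ospBit n ((a : ZMod (2 * n)) + d) then 0
        else ospWeight n (a : ZMod (2 * n)) * ospWeight n ((a : ZMod (2 * n)) + d)) =
      if n ≤ a + d then ospProfile n a * ospProfile n (a + d - n) else 0 := by
    intro a ha
    have ha' := Finset.mem_range.1 ha
    rw [← ospWeight_natCast ha']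
    have := congrArg (ospWeight n (a : ZMod (2 * n)) * ·) (ite_ospBit_add ha' hdn)
    simpa only [mul_ite, mul_zero] using this
  rw [Finset.sum_congr rfl h1]
  have h2 := one_le_sum_ospProfile hd hdn
  have h3 : ∑ a ∈ Finset.range n,
        (if n ≤ a + d then ospProfile n a * ospProfile n (a + d - n) else 0) =
      ∑ b ∈ Finset.range d, ospProfile n (n - d + b) * ospProfile n b := by
    conv_lhs => rw [show Finset.range n = Finset.range (n - d + d) by rw [Nat.sub_add_cancel hdn]]
    rw [Finset.sum_range_add, Finset.sum_eq_zero, zero_add]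
    · refine Finset.sum_congr rfl fun b _ => ?_
      rw [if_pos (by omega), show n - d + b + d - n = b by omega]
    · intro a ha
      have := Finset.mem_range.1 ha
      rw [if_neg (by omega)]
  rw [h3]
  linarith

lemma two_le_sum_ospWeight {d : ZMod (2 * n)} (hd : d ≠ 0) :
    2 ≤ ∑ c : ZMod (2 * n),
      if ospBit n c ↔ ospBit n (c + d) then 0 else ospWeight n c * ospWeight n (c + d) := by
  have hpos : 1 ≤ d.val := Nat.one_le_iff_ne_zero.2 (by rwa [Ne, ZMod.val_eq_zero])
  have hlt := ZMod.val_lt d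
  by_cases h : d.val ≤ n
  · have := two_le_sum_ospWeight_natCast hpos h
    rwa [ZMod.natCast_zmod_val] at this
  · -- A distance beyond `n` is a distance below `n` in the other direction.
    have h2 := two_le_sum_ospWeight_natCast (n := n) (d := 2 * n - d.val) (by omega) (by omega)
    rw [Nat.cast_sub hlt.le, ZMod.natCast_self, zero_sub, ZMod.natCast_zmod_val] at h2
    rw [← Equiv.sum_comp (Equiv.addRight d)] at h2
    refine h2.trans (le_of_eq (Finset.sum_congr rfl fun c _ => ?_))
    simp only [Equiv.coe_addRight, add_neg_cancel_right]
    rw [mul_comm (ospWeight n _)]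
    simp only [iff_comm (a := ospBit n c)]

lemma two_le_sum_ospWeight_shift {k l : ZMod (2 * n)} (hkl : k ≠ l) :
    2 ≤ ∑ i : Fin (2 * n), if ospBit n ((i.1 : ZMod (2 * n)) + k) ↔ ospBit n ((i.1 : ZMod (2 * n)) + l)
      then 0 else ospWeight n ((i.1 : ZMod (2 * n)) + k) * ospWeight n ((i.1 : ZMod (2 * n)) + l) := by
  rw [sum_fin_eq_sum_zmod (fun c => if ospBit n (c + k) ↔ ospBit n (c + l) then 0
    else ospWeight n (c + k) * ospWeight n (c + l))]
  refine (two_le_sum_ospWeight (sub_ne_zero.2 hkl.symm)).trans (le_of_eq ?_)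
  rw [← Equiv.sum_comp (Equiv.addRight k)]
  simp only [Equiv.coe_addRight, add_assoc, add_sub_cancel]

lemma sum_ospWeight_sq (k : ZMod (2 * n)) :
    ∑ i : Fin (2 * n), ospWeight n ((i.1 : ZMod (2 * n)) + k) ^ 2 = 2 * ospValue n := by
  rw [sum_fin_eq_sum_zmod (fun c => ospWeight n (c + k) ^ 2),
    show ∑ c, ospWeight n (c + k) ^ 2 = ∑ c, ospWeight n c ^ 2 from
      Equiv.sum_comp (Equiv.addRight k) (fun c => ospWeight n c ^ 2),
    sum_zmod_eq_two_mul_of_periodic (fun c => by rw [ospWeight_add_half])]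
  congr 1
  exact Finset.sum_congr rfl fun a ha => by rw [ospWeight_natCast (Finset.mem_range.1 ha)]

/-! ### The upper bound for ordered search -/

lemma ospString_val (k : ZMod (2 * n)) (i : Fin (2 * n)) :
    ospString n k.val i = decide (ospBit n ((i.1 : ZMod (2 * n)) + k)) := by
  refine decide_eq_decide.2 ?_
  unfold ospBit
  rw [ZMod.val_add, ZMod.val_natCast_of_lt i.2]

lemma ospString_val_injective : Function.Injective fun k : ZMod (2 * n) => ospString n k.val := by
  intro k l h
  by_contra hkl
  have h2 := two_le_sum_ospWeight_shift hkl
  rw [Finset.sum_eq_zero] at h2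
  · norm_num at h2
  · intro i _
    have := congrFun h i
    simp only [ospString_val, decide_eq_decide] at this
    rw [if_pos this]

/-- The inputs of the problem, parametrized by the shift. -/
noncomputable def ospShiftEquiv (n : ℕ) [NeZero n] : ZMod (2 * n) ≃ ospInputs n :=
  Equiv.ofBijective
    (fun k => ⟨ospString n k.val, Finset.mem_image_of_mem _ (Finset.mem_range.2 (ZMod.val_lt k))⟩)
    ⟨fun _ _ h => ospString_val_injective (congrArg Subtype.val h), by
      rintro ⟨x, hx⟩
      obtain ⟨k, hk, rfl⟩ := Finset.mem_image.1 hx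
      refine ⟨(k : ZMod (2 * n)), Subtype.ext ?_⟩
      simp only
      rw [ZMod.val_natCast_of_lt (Finset.mem_range.1 hk)]⟩

lemma ospShiftEquiv_apply (k : ZMod (2 * n)) (i : Fin (2 * n)) :
    (ospShiftEquiv n k).1 i = decide (ospBit n ((i.1 : ZMod (2 * n)) + k)) :=
  ospString_val k i

lemma ospInput_apply (x : ospInputs n) (i : Fin (2 * n)) :
    x.1 i = decide (ospBit n ((i.1 : ZMod (2 * n)) + (ospShiftEquiv n).symm x)) := by
  rw [← ospShiftEquiv_apply, Equiv.apply_symm_apply]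

lemma ospValue_nonneg (n : ℕ) : 0 ≤ ospValue n := Finset.sum_nonneg fun _ _ => sq_nonneg _

lemma ospValue_pos (n : ℕ) [NeZero n] : 0 < ospValue n :=
  Finset.sum_pos (fun a _ => pow_pos (ospProfile_pos n a) 2)
    ⟨0, Finset.mem_range.2 (Nat.pos_of_ne_zero (NeZero.ne n))⟩

theorem matSpectralNorm_le_ospValue_mul {Γ : Matrix (ospInputs n) (ospInputs n) ℝ}
    (hΓ : IsAdversaryMatrix (OSP n) Γ) :
    matSpectralNorm Γ ≤ ospValue n *
      ⨆ i : Fin (2 * n), matSpectralNorm (Matrix.hadamard Γ (queryMatrix (ospInputs n) i)) := by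
  refine matSpectralNorm_le_of_weights hΓ (κ := 2)
    (p := fun x i => ospWeight n ((i.1 : ZMod (2 * n)) + (ospShiftEquiv n).symm x))
    two_pos (ospValue_nonneg n) ?_ ?_
  · intro x y hxy
    have hne : (ospShiftEquiv n).symm x ≠ (ospShiftEquiv n).symm y := fun h =>
      hxy (congrArg (OSP n) ((ospShiftEquiv n).symm.injective h))
    refine (two_le_sum_ospWeight_shift hne).trans (le_of_eq ?_)
    refine Finset.sum_congr rfl fun i _ => ?_
    simp only [ospInput_apply, ne_eq, decide_eq_decide, ite_not]
  · intro x
    exact (sum_ospWeight_sq _).le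

end OrderedSearch

/-! ### The lower bound for ordered search -/

section OrderedSearchLower

/-- The right-hand side `c` of the triangular Toeplitz system `ξ * s = c` that makes the weight
profile a fixed vector. With `M = (n - 1) / 2` it is `c_r = ξ_{M - r}`, except that `c_0` is halved
for odd `n`, when the middle entry of the profile is reached from both sides. -/
noncomputable def ospTarget (n r : ℕ) : ℝ :=
  if r = 0 ∧ n % 2 = 1 then xi ((n - 1) / 2) / 2 else xi ((n - 1) / 2 - r)

/-- The increments `c_r - c_{r - 1}`, with `c_{-1} = 0`. -/
noncomputable def ospTargetDiff (n : ℕ) : ℕ → ℝ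
  | 0 => ospTarget n 0
  | r + 1 => ospTarget n (r + 1) - ospTarget n r

/-- The solution `s` of `ξ * s = c`. As `ξ * ξ` is constantly `1`, it is the convolution of `ξ` with
the increments of `c`. -/
noncomputable def ospCoeff (n j : ℕ) : ℝ :=
  PowerSeries.coeff j (PowerSeries.mk xi * PowerSeries.mk (ospTargetDiff n))

lemma ospTarget_nonneg (n r : ℕ) : 0 ≤ ospTarget n r := by
  unfold ospTarget
  split_ifs
  · exact (half_pos (xi_pos _)).le
  · exact (xi_pos _).le

lemma ospTargetDiff_nonneg (n r : ℕ) : 0 ≤ ospTargetDiff n r := by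
  cases r with
  | zero => exact ospTarget_nonneg n 0
  | succ r =>
    refine sub_nonneg.2 ?_
    unfold ospTarget
    rw [if_neg (c := r + 1 = 0 ∧ n % 2 = 1) (by omega)]
    have h : xi ((n - 1) / 2 - r) ≤ xi ((n - 1) / 2 - (r + 1)) := xi_antitone (by omega)
    split_ifs with hr
    · rw [hr.1, Nat.sub_zero] at h
      rw [hr.1]
      linarith [xi_pos ((n - 1) / 2)]
    · exact h

lemma ospCoeff_nonneg (n j : ℕ) : 0 ≤ ospCoeff n j := by
  unfold ospCoeff
  rw [PowerSeries.coeff_mul]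
  refine Finset.sum_nonneg fun p _ => ?_
  rw [PowerSeries.coeff_mk, PowerSeries.coeff_mk]
  exact mul_nonneg (xi_pos _).le (ospTargetDiff_nonneg _ _)

lemma mk_xi_mul_mk_xi : PowerSeries.mk xi * PowerSeries.mk xi = PowerSeries.mk fun _ => (1 : ℝ) := by
  ext r
  simp only [PowerSeries.coeff_mul, PowerSeries.coeff_mk]
  exact sum_antidiagonal_xi r

lemma coeff_mk_one_mul (F : PowerSeries ℝ) (r : ℕ) :
    PowerSeries.coeff r ((PowerSeries.mk fun _ => (1 : ℝ)) * F) =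
      ∑ j ∈ Finset.range (r + 1), PowerSeries.coeff j F := by
  rw [mul_comm, PowerSeries.coeff_mul, Finset.Nat.sum_antidiagonal_eq_sum_range_succ_mk]
  simp

lemma mk_xi_mul_mk_ospCoeff (n : ℕ) :
    PowerSeries.mk xi * PowerSeries.mk (ospCoeff n) = PowerSeries.mk (ospTarget n) := by
  have h : PowerSeries.mk (ospCoeff n) = PowerSeries.mk xi * PowerSeries.mk (ospTargetDiff n) := by
    ext j
    rw [PowerSeries.coeff_mk, ospCoeff]
  rw [h, ← mul_assoc, mk_xi_mul_mk_xi]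
  ext r
  simp only [coeff_mk_one_mul, PowerSeries.coeff_mk]
  induction r with
  | zero => simp [ospTargetDiff]
  | succ r ih => rw [Finset.sum_range_succ, ih, ospTargetDiff]; ring

lemma sum_ospCoeff_mul_xi (n r : ℕ) :
    ∑ j ∈ Finset.range (r + 1), ospCoeff n j * xi (r - j) = ospTarget n r := by
  have h := congrArg (PowerSeries.coeff r) (mk_xi_mul_mk_ospCoeff n)
  rw [mul_comm, PowerSeries.coeff_mul, Finset.Nat.sum_antidiagonal_eq_sum_range_succ_mk] at h
  simpa only [PowerSeries.coeff_mk] using h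

lemma two_mul_sum_ospCoeff {n : ℕ} (hn : 1 ≤ n) :
    2 * ∑ j ∈ Finset.range ((n - 1) / 2 + 1), ospCoeff n j = ospValue n := by
  have h1 : ∑ j ∈ Finset.range ((n - 1) / 2 + 1), ospCoeff n j =
      ∑ r ∈ Finset.range ((n - 1) / 2 + 1), ospTarget n r * xi ((n - 1) / 2 - r) := by
    have h := coeff_mk_one_mul (PowerSeries.mk (ospCoeff n)) ((n - 1) / 2)
    rw [← mk_xi_mul_mk_xi, mul_assoc, mk_xi_mul_mk_ospCoeff, mul_comm, PowerSeries.coeff_mul,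
      Finset.Nat.sum_antidiagonal_eq_sum_range_succ_mk] at h
    simp only [PowerSeries.coeff_mk] at h
    exact h.symm
  have h2 : ∑ r ∈ Finset.range ((n - 1) / 2 + 1), xi ((n - 1) / 2 - r) ^ 2 =
      ∑ i ∈ Finset.range ((n + 1) / 2), xi i ^ 2 := by
    rw [show (n + 1) / 2 = (n - 1) / 2 + 1 by omega,
      ← Finset.sum_range_reflect (fun i => xi i ^ 2)]
    exact Finset.sum_congr rfl fun r _ => by rw [Nat.add_sub_cancel]
  rw [h1, ospValue_eq, ← h2]
  rcases Nat.mod_two_eq_zero_or_one n with hpar | hpar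
  · have h3 : ∑ r ∈ Finset.range ((n - 1) / 2 + 1), ospTarget n r * xi ((n - 1) / 2 - r) =
        ∑ r ∈ Finset.range ((n - 1) / 2 + 1), xi ((n - 1) / 2 - r) ^ 2 := by
      refine Finset.sum_congr rfl fun r _ => ?_
      unfold ospTarget
      rw [if_neg (by omega), sq]
    rw [h3, h2, show (n + 1) / 2 = n / 2 by omega]
    ring
  · have h3 : ∑ r ∈ Finset.range ((n - 1) / 2), ospTarget n (r + 1) * xi ((n - 1) / 2 - (r + 1)) =
        ∑ i ∈ Finset.range (n / 2), xi i ^ 2 := by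
      rw [show n / 2 = (n - 1) / 2 by omega,
        ← Finset.sum_range_reflect (fun i => xi i ^ 2)]
      refine Finset.sum_congr rfl fun r _ => ?_
      unfold ospTarget
      rw [if_neg (by omega), sq, show (n - 1) / 2 - 1 - r = (n - 1) / 2 - (r + 1) by omega]
    have h4 : ∑ r ∈ Finset.range ((n - 1) / 2), xi ((n - 1) / 2 - (r + 1)) ^ 2 =
        ∑ i ∈ Finset.range (n / 2), xi i ^ 2 := by
      rw [show n / 2 = (n - 1) / 2 by omega,
        ← Finset.sum_range_reflect (fun i => xi i ^ 2)]
      refine Finset.sum_congr rfl fun r _ => ?_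
      rw [show (n - 1) / 2 - 1 - r = (n - 1) / 2 - (r + 1) by omega]
    rw [Finset.sum_range_succ', Finset.sum_range_succ', h3, h4]
    unfold ospTarget
    rw [if_pos ⟨rfl, hpar⟩, Nat.sub_zero]
    ring

/-- The contribution of the backward moves to the fixed-vector equation at position `a`. -/
lemma sum_ospCoeff_mul_ospProfile {n a : ℕ} (ha : a < n) :
    ∑ j ∈ Finset.range ((n - 1) / 2 + 1), ospCoeff n j *
        (if a < (n - 1) / 2 + 1 - j then ospProfile n (n + a - ((n - 1) / 2 + 1 - j)) else 0) =
      if a ≤ (n - 1) / 2 then ospTarget n ((n - 1) / 2 - a) else 0 := by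
  split_ifs with h
  · rw [← sum_ospCoeff_mul_xi]
    symm
    refine Finset.sum_subset_zero_on_sdiff (Finset.range_mono (by omega)) ?_ ?_
    · intro j hj
      have hj' := Finset.mem_sdiff.1 hj
      simp only [Finset.mem_range] at hj'
      rw [if_neg (by omega), mul_zero]
    · intro j hj
      have hj' := Finset.mem_range.1 hj
      rw [if_pos (by omega), ospProfile]
      congr 2
      omega
  · refine Finset.sum_eq_zero fun j _ => ?_
    rw [if_neg (by omega), mul_zero]

/-- The backward moves from `a` and, by reflection, the forward ones add up to the profile. For odd
`n` both contribute at the middle position, whence the halving in `ospTarget`. -/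
lemma ospTarget_add_reflect {n a : ℕ} (ha : a < n) :
    (if n - 1 - a ≤ (n - 1) / 2 then ospTarget n ((n - 1) / 2 - (n - 1 - a)) else 0) +
      (if a ≤ (n - 1) / 2 then ospTarget n ((n - 1) / 2 - a) else 0) = ospProfile n a := by
  unfold ospTarget ospProfile
  rcases lt_trichotomy a (n - 1 - a) with h | h | h
  · rw [if_neg (by omega), if_pos (by omega), if_neg (by omega), zero_add]
    congr 1
    omega
  · rw [if_pos (by omega), if_pos (by omega), if_pos (by omega), if_pos (by omega), add_halves]
    congr 1
    omega
  · rw [if_pos (by omega), if_neg (by omega), if_neg (by omega), add_zero]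
    congr 1
    omega

variable {n : ℕ}

/-- The `j`th shift distance `(n - 1) / 2 + 1 - j` carrying the coefficient `ospCoeff n j`. -/
def ospShift (n j : ℕ) : ZMod (2 * n) := ((n - 1) / 2 + 1 - j : ℕ)

/-- The optimal adversary matrix, indexed by shifts: a symmetric circulant matrix. -/
noncomputable def ospCirculant (n : ℕ) (k l : ZMod (2 * n)) : ℝ :=
  ∑ j ∈ Finset.range ((n - 1) / 2 + 1), ospCoeff n j *
    ((if l = k + ospShift n j then 1 else 0) + (if l = k - ospShift n j then 1 else 0))

lemma ospCirculant_nonneg (k l : ZMod (2 * n)) : 0 ≤ ospCirculant n k l := by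
  refine Finset.sum_nonneg fun j _ => mul_nonneg (ospCoeff_nonneg n j) ?_
  split_ifs <;> norm_num

lemma ospCirculant_symm (k l : ZMod (2 * n)) : ospCirculant n k l = ospCirculant n l k := by
  unfold ospCirculant
  refine Finset.sum_congr rfl fun j _ => ?_
  rw [add_comm]
  simp only [eq_sub_iff_add_eq, eq_comm (a := l + ospShift n j), eq_comm (a := k + ospShift n j)]

variable [NeZero n]

lemma ospShift_ne_zero {j : ℕ} (hj : j < (n - 1) / 2 + 1) : ospShift n j ≠ 0 := by
  have hn := Nat.pos_of_ne_zero (NeZero.ne n)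
  intro h
  have h1 := congrArg ZMod.val h
  rw [ospShift, ZMod.val_natCast_of_lt (by omega), ZMod.val_zero] at h1
  omega

lemma ospCirculant_self (k : ZMod (2 * n)) : ospCirculant n k k = 0 := by
  refine Finset.sum_eq_zero fun j hj => ?_
  have h := ospShift_ne_zero (n := n) (Finset.mem_range.1 hj)
  rw [if_neg (by simpa using h), if_neg (by simpa [eq_sub_iff_add_eq] using h), add_zero, mul_zero]

lemma sum_ospCirculant_mul (k : ZMod (2 * n)) (φ : ZMod (2 * n) → ℝ) :
    ∑ l, ospCirculant n k l * φ l = ∑ j ∈ Finset.range ((n - 1) / 2 + 1),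
      ospCoeff n j * (φ (k + ospShift n j) + φ (k - ospShift n j)) := by
  unfold ospCirculant
  simp only [Finset.sum_mul]
  rw [Finset.sum_comm]
  refine Finset.sum_congr rfl fun j _ => ?_
  simp only [mul_assoc, ← Finset.mul_sum, add_mul, Finset.sum_add_distrib, ite_mul, one_mul,
    zero_mul, Finset.sum_ite_eq', Finset.mem_univ, if_true]

/-- The fixed-vector equation on the cycle. -/
lemma sum_ospCoeff_mul_ospWeight (c : ZMod (2 * n)) :
    ∑ j ∈ Finset.range ((n - 1) / 2 + 1), ospCoeff n j *
      ((if ospBit n c ↔ ospBit n (c + ospShift n j) then 0 else ospWeight n (c + ospShift n j)) +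
       (if ospBit n c ↔ ospBit n (c - ospShift n j) then 0 else ospWeight n (c - ospShift n j))) =
      ospWeight n c := by
  have key : ∀ a < n, ∑ j ∈ Finset.range ((n - 1) / 2 + 1), ospCoeff n j *
      ((if ospBit n a ↔ ospBit n (a + ospShift n j) then 0 else ospWeight n (a + ospShift n j)) +
       (if ospBit n a ↔ ospBit n (a - ospShift n j) then 0 else ospWeight n (a - ospShift n j))) =
      ospWeight n a := by
    intro a ha
    rw [ospWeight_natCast ha, ← ospTarget_add_reflect ha,
      ← sum_ospCoeff_mul_ospProfile (show n - 1 - a < n by omega),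
      ← sum_ospCoeff_mul_ospProfile ha, ← Finset.sum_add_distrib]
    refine Finset.sum_congr rfl fun j hj => ?_
    have hj' := Finset.mem_range.1 hj
    unfold ospShift
    rw [ite_ospBit_add ha (by omega), ite_ospBit_sub ha (by omega), mul_add]
    congr 2
    by_cases h : n ≤ a + ((n - 1) / 2 + 1 - j)
    · rw [if_pos h, if_pos (by omega), ← ospProfile_reflect (by omega)]
      congr 1
      omega
    · rw [if_neg h, if_neg (by omega)]
  obtain ⟨a, ha, rfl | rfl⟩ := exists_natCast_or_add_half c
  · exact key a ha
  · rw [ospWeight_add_half, ← key a ha]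
    refine Finset.sum_congr rfl fun j _ => ?_
    rw [add_right_comm, add_sub_right_comm, ospWeight_add_half, ospWeight_add_half]
    simp only [ospBit_add_half, not_iff_not]

/-- The optimal adversary matrix for the symmetrized ordered search problem. -/
noncomputable def ospMatrix (n : ℕ) [NeZero n] : Matrix (ospInputs n) (ospInputs n) ℝ :=
  Matrix.of fun x y => ospCirculant n ((ospShiftEquiv n).symm x) ((ospShiftEquiv n).symm y)

lemma sum_ospMatrix_mul (x : ospInputs n) (φ : ZMod (2 * n) → ℝ) :
    ∑ y, ospMatrix n x y * φ ((ospShiftEquiv n).symm y) =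
      ∑ l, ospCirculant n ((ospShiftEquiv n).symm x) l * φ l :=
  Equiv.sum_comp (ospShiftEquiv n).symm
    (fun l => ospCirculant n ((ospShiftEquiv n).symm x) l * φ l)

lemma ospMatrix_row_sum (x : ospInputs n) : ∑ y, ospMatrix n x y = ospValue n := by
  have h := sum_ospMatrix_mul x (fun _ => 1)
  simp only [mul_one] at h
  rw [h]
  have h2 := sum_ospCirculant_mul ((ospShiftEquiv n).symm x) (fun _ => 1)
  simp only [mul_one] at h2
  rw [h2, ← Finset.sum_mul,
    ← two_mul_sum_ospCoeff (Nat.one_le_iff_ne_zero.2 (NeZero.ne n))]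
  ring

lemma matSpectralNorm_ospMatrix_hadamard_le (i : Fin (2 * n)) :
    matSpectralNorm (Matrix.hadamard (ospMatrix n) (queryMatrix (ospInputs n) i)) ≤ 1 := by
  refine matSpectralNorm_le_one_of_fixed_vector
    (p := fun x => ospWeight n ((i.1 : ZMod (2 * n)) + (ospShiftEquiv n).symm x)) ?_ ?_
    (fun x => ospWeight_pos _) ?_
  · intro x y
    simp only [Matrix.hadamard_apply, queryMatrix, Matrix.of_apply]
    refine mul_nonneg (ospCirculant_nonneg _ _) ?_
    split_ifs <;> norm_num
  · intro x y
    simp only [Matrix.hadamard_apply, queryMatrix, Matrix.of_apply, ospMatrix]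
    rw [ospCirculant_symm]
    simp only [ne_comm]
  · intro x
    rw [← sum_ospCoeff_mul_ospWeight ((i.1 : ZMod (2 * n)) + (ospShiftEquiv n).symm x)]
    have h := sum_ospMatrix_mul x (fun l =>
      if ospBit n ((i.1 : ZMod (2 * n)) + (ospShiftEquiv n).symm x) ↔
        ospBit n ((i.1 : ZMod (2 * n)) + l) then 0 else ospWeight n ((i.1 : ZMod (2 * n)) + l))
    rw [sum_ospCirculant_mul] at h
    simp only [← add_assoc, ← add_sub_assoc] at h
    rw [← h]
    refine Finset.sum_congr rfl fun y _ => ?_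
    simp only [Matrix.hadamard_apply, queryMatrix, Matrix.of_apply, ospInput_apply, ne_eq,
      decide_eq_decide, ite_not, mul_ite, ite_mul, mul_one, mul_zero, zero_mul]

lemma isAdversaryMatrix_ospMatrix : IsAdversaryMatrix (OSP n) (ospMatrix n) where
  nonneg _ _ := ospCirculant_nonneg _ _
  ne_zero h := by
    have h1 := ospMatrix_row_sum (ospShiftEquiv n 0)
    rw [h] at h1
    simp only [Matrix.zero_apply, Finset.sum_const_zero] at h1
    exact (ospValue_pos n).ne h1
  eq_zero_of_eq x y hxy := by
    obtain rfl : x = y := Subtype.ext hxy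
    exact ospCirculant_self _

theorem isGreatest_adversaryValues_OSP :
    IsGreatest (adversaryValues (OSP n)) (ospValue n) := by
  refine ⟨⟨ospMatrix n, isAdversaryMatrix_ospMatrix, ?_⟩, ?_⟩
  · have : Nonempty (ospInputs n) := ⟨ospShiftEquiv n 0⟩
    have hup := matSpectralNorm_le_ospValue_mul (isAdversaryMatrix_ospMatrix (n := n))
    have hlow := le_matSpectralNorm_of_row_sum (ospMatrix_row_sum (n := n))
    have hsup : (⨆ i : Fin (2 * n),
        matSpectralNorm (Matrix.hadamard (ospMatrix n) (queryMatrix (ospInputs n) i))) ≤ 1 :=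
      Real.iSup_le matSpectralNorm_ospMatrix_hadamard_le zero_le_one
    have hV := ospValue_pos n
    -- The two bounds on the norm force the supremum to be exactly `1`.
    have hone : (⨆ i : Fin (2 * n),
        matSpectralNorm (Matrix.hadamard (ospMatrix n) (queryMatrix (ospInputs n) i))) = 1 :=
      le_antisymm hsup (le_of_mul_le_mul_left (by linarith) hV)
    rw [hone] at hup
    unfold adversaryValue
    rw [hone, div_one]
    linarith
  · rintro _ ⟨Γ, hΓ, rfl⟩
    exact div_le_of_le_mul₀ (Real.iSup_nonneg fun i => matSpectralNorm_nonneg _)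
      (ospValue_nonneg n) (matSpectralNorm_le_ospValue_mul hΓ)

lemma ADV_OSP : ADV (OSP n) = ospValue n := isGreatest_adversaryValues_OSP.csSup_eq

end OrderedSearchLower

/-! ### The adversary value of ordered search -/

/-- Replacing `n / 2` by the neighbouring integer changes its logarithm by `O(1 / n)`. -/
lemma abs_log_sub_log_half_le {n m : ℕ} (hm : 1 ≤ m) (h1 : n ≤ 2 * m + 1) (h2 : 2 * m ≤ n + 1) :
    |Real.log m - (Real.log n - Real.log 2)| ≤ 3 / n := by
  have hn : 1 ≤ n := by omega
  have hm' : (1 : ℝ) ≤ m := by exact_mod_cast hm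
  have hn' : (1 : ℝ) ≤ n := by exact_mod_cast hn
  have h1' : (n : ℝ) ≤ 2 * m + 1 := by exact_mod_cast h1
  have h2' : (2 * m : ℝ) ≤ n + 1 := by exact_mod_cast h2
  rw [← sub_add, sub_add_eq_add_sub, ← Real.log_mul (by positivity) two_ne_zero,
    ← Real.log_div (by positivity) (by positivity), abs_le]
  have hpos : (0 : ℝ) < m * 2 / n := by positivity
  constructor
  · refine le_trans ?_ (Real.one_sub_inv_le_log_of_pos hpos)
    rw [inv_div, ← neg_div, one_sub_div (by positivity),
      div_le_div_iff₀ (by positivity) (by positivity)]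
    nlinarith
  · refine (Real.log_le_sub_one_of_pos hpos).trans ?_
    rw [div_sub_one (by positivity), div_le_div_iff_of_pos_right (by positivity)]
    linarith

lemma abs_ospValue_sub_le {n : ℕ} (hn : 2 ≤ n) :
    |ospValue n - 2 / Real.pi * (Real.log n + Real.eulerMascheroniConstant + Real.log 8)| ≤
      14 / Real.pi * (1 / n) := by
  -- Each half of the profile contributes the asymptotics at `m ∈ {n / 2, (n + 1) / 2}`.
  have key : ∀ m : ℕ, 1 ≤ m → n ≤ 2 * m + 1 → 2 * m ≤ n + 1 →
      |∑ i ∈ Finset.range m, xi i ^ 2 -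
        1 / Real.pi * (Real.log n + Real.eulerMascheroniConstant + Real.log 8)| ≤
        7 / Real.pi * (1 / n) := by
    intro m hm h1 h2
    have hs := abs_sum_xi_sq_sub_le hm
    have hl := abs_log_sub_log_half_le hm h1 h2
    have hn' : (2 : ℝ) ≤ n := by exact_mod_cast hn
    have hm' : (1 : ℝ) ≤ m := by exact_mod_cast hm
    have h1' : (n : ℝ) ≤ 2 * m + 1 := by exact_mod_cast h1
    have hinv : 1 / (m : ℝ) ≤ 4 / n := by
      rw [div_le_div_iff₀ (by positivity) (by positivity)]
      linarith
    have e8 : Real.log 16 = Real.log 8 + Real.log 2 := by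
      rw [← Real.log_mul (by norm_num) two_ne_zero]; norm_num
    have hpi : 0 < 1 / Real.pi := by positivity
    have hinv' := mul_le_mul_of_nonneg_left hinv hpi.le
    have hl' := mul_le_mul_of_nonneg_left hl hpi.le
    rw [← abs_of_pos hpi, ← abs_mul, abs_of_pos hpi] at hl'
    rw [e8] at hs
    calc _ = |(∑ i ∈ Finset.range m, xi i ^ 2 - 1 / Real.pi *
            (Real.log m + Real.eulerMascheroniConstant + (Real.log 8 + Real.log 2))) +
            1 / Real.pi * (Real.log m - (Real.log n - Real.log 2))| := by congr 1; ring
      _ ≤ 1 / Real.pi * (4 / n) + 1 / Real.pi * (3 / n) :=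
          (abs_add_le _ _).trans (add_le_add (hs.trans hinv') hl')
      _ = _ := by ring
  have ha := key ((n + 1) / 2) (by omega) (by omega) (by omega)
  have hb := key (n / 2) (by omega) (by omega) (by omega)
  rw [ospValue_eq]
  calc _ = |(∑ i ∈ Finset.range ((n + 1) / 2), xi i ^ 2 -
          1 / Real.pi * (Real.log n + Real.eulerMascheroniConstant + Real.log 8)) +
        (∑ i ∈ Finset.range (n / 2), xi i ^ 2 -
          1 / Real.pi * (Real.log n + Real.eulerMascheroniConstant + Real.log 8))| := by
        congr 1; ring
    _ ≤ _ := (abs_add_le _ _).trans (add_le_add ha hb)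
    _ = _ := by ring

theorem corollary2 :
    (∀ n : ℕ, 1 ≤ n → IsGreatest (adversaryValues (OSP n)) (ADV (OSP n))) ∧
    ((fun n : ℕ => ADV (OSP n) -
        2 / Real.pi * (Real.log n + Real.eulerMascheroniConstant + Real.log 8))
      =O[Filter.atTop] (fun n : ℕ => 1 / (n : ℝ))) ∧
    ((fun m : ℕ => (∑ i ∈ Finset.range m, xi i ^ 2) -
        1 / Real.pi * (Real.log m + Real.eulerMascheroniConstant + Real.log 16))
      =O[Filter.atTop] (fun m : ℕ => 1 / (m : ℝ))) := by
  refine ⟨fun n hn => ?_, ?_, ?_⟩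
  · have : NeZero n := ⟨by omega⟩
    rw [ADV_OSP]
    exact isGreatest_adversaryValues_OSP
  · refine Asymptotics.IsBigO.of_bound (14 / Real.pi) ?_
    filter_upwards [Filter.eventually_ge_atTop 2] with n hn
    have : NeZero n := ⟨by omega⟩
    rw [ADV_OSP, Real.norm_eq_abs, Real.norm_of_nonneg (by positivity)]
    exact abs_ospValue_sub_le hn
  · refine Asymptotics.IsBigO.of_bound (1 / Real.pi) ?_
    filter_upwards [Filter.eventually_ge_atTop 1] with m hm
    rw [Real.norm_eq_abs, Real.norm_of_nonneg (by positivity)]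
    exact abs_sum_xi_sq_sub_le hm
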